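/- Let $\mathbb F$ be a field and let $G$ be a $k\times n$ matrix of rank $k$ with entries in $\mathbb F[D]$ (a polynomial generating matrix), with rows $g_1,\dots,g_k$. For a vector $u$ of Laurent series over $\mathbb F$ let $\mathcal K(u)$ be its causal part (the terms with exponents $\ge 0$) and $\mathcal Z(u)=u-\mathcal K(u)$ its anticausal part, both taken componentwise. The encoding state space of $G$ is the $\mathbb F$-vector space $$\Sigma_G=\mathbb F((D))^k\big/\{u\in\mathbb F((D))^k \mid \mathcal K(\mathcal Z(u)G)=0\}.$$ An encoder of degree $m$ is an $\mathbb F$-linear map $K:\mathbb F^m\times\mathbb F^k\to\mathbb F^m\times\mathbb F^n$. It realizes $G$ if for every $u=\sum_t u_tD^t\in\mathbb F((D))^k$, with $uG=\sum_t v_tD^t$, there are states $s_t\in\mathbb F^m$ $(t\in\mathbb Z)$ with $s_t=0$ for all sufficiently small $t$ and $K(s_t,u_t)=(s_{t+1},v_t)$ for all $t$. The McMillan degree $\operatorname{mdeg}G$ is the smallest degree of an encoder realizing $G$. The internal degree $\operatorname{intdeg}G$ is the largest degree of a $k\times k$ minor of $G$. The external degree is $\operatorname{extdeg}G=\sum_{i=1}^k\deg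 g_i$, where $\deg g_i$ is the largest degree of an entry of $g_i$. The matrix $G$ is reduced if its external degree cannot be lowered by adding to one row a linear combination, with coefficients in $\mathbb F[D]$, of the other rows. Then $G$ is realized by some encoder, so that $\operatorname{mdeg}G$ is well defined; $\Sigma_G$ is finite-dimensional, and $$\operatorname{intdeg}G\le\operatorname{mdeg}G=\dim_{\mathbb F}\Sigma_G .$$ If $G$ is reduced, then $$\operatorname{intdeg}G=\operatorname{mdeg}G=\operatorname{extdeg}G .$$ -/

import Mathlib

open scoped LaurentSeries Polynomial Matrix

namespace ConvCode

noncomputable section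

variable {F : Type*} [Field F] {k n : ℕ}

/-- The anticausal part `Z(u) = ∑_{j < 0} u_j D^j` of a Laurent series. -/
def anticausal (u : F⸨X⸩) : F⸨X⸩ := HahnSeries.truncLTLinearMap F (0 : ℤ) u

/-- The causal part `K(u) = ∑_{j ≥ 0} u_j D^j` of a Laurent series. -/
def causal (u : F⸨X⸩) : F⸨X⸩ := u - anticausal u

theorem anticausal_coeff (u : F⸨X⸩) (j : ℤ) :
    (anticausal u).coeff j = if j < 0 then u.coeff j else 0 := by
  simp [anticausal]

theorem causal_coeff (u : F⸨X⸩) (j : ℤ) :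
    (causal u).coeff j = if j < 0 then 0 else u.coeff j := by
  simp only [causal, HahnSeries.coeff_sub, anticausal_coeff]
  split_ifs <;> simp

theorem anticausal_add (u v : F⸨X⸩) : anticausal (u + v) = anticausal u + anticausal v :=
  map_add _ _ _

theorem anticausal_smul (c : F) (u : F⸨X⸩) : anticausal (c • u) = c • anticausal u :=
  map_smul _ _ _

/-- The anticausal part as an `F`-linear map on vectors of series. -/
def anticausalVec (k : ℕ) : (Fin k → F⸨X⸩) →ₗ[F] (Fin k → F⸨X⸩) where
  toFun u i := anticausal (u i)
  map_add' u v := by ext1 i; exact anticausal_add _ _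
  map_smul' c u := by ext1 i; exact anticausal_smul _ _

/-- The causal part as an `F`-linear map on vectors of series. -/
def causalVec (k : ℕ) : (Fin k → F⸨X⸩) →ₗ[F] (Fin k → F⸨X⸩) where
  toFun u i := causal (u i)
  map_add' u v := by
    ext1 i
    simp only [causal, Pi.add_apply, anticausal_add]
    abel
  map_smul' c u := by
    ext1 i
    simp only [causal, Pi.smul_apply, anticausal_smul, smul_sub, RingHom.id_apply]

theorem smul_vecMul (c : F) (u : Fin k → F⸨X⸩) (G : Matrix (Fin k) (Fin n) F⸨X⸩) :
    (c • u) ᵥ* G = c • (u ᵥ* G) := by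
  have h : ∀ m : ℕ, ∀ w : Fin m → F⸨X⸩, c • w = (HahnSeries.C c : F⸨X⸩) • w := by
    intro m w
    ext1 i
    simp only [Pi.smul_apply, smul_eq_mul, HahnSeries.C_mul_eq_smul]
  rw [h, h, Matrix.smul_vecMul]

/-- The set of all `u ∈ F((D))^k` with `K(Z(u) G) = 0`, a vector space over `F`. -/
def zeroStates (G : Matrix (Fin k) (Fin n) F⸨X⸩) : Submodule F (Fin k → F⸨X⸩) where
  carrier := {u | causalVec n (anticausalVec k u ᵥ* G) = 0}
  zero_mem' := by simp
  add_mem' {u v} hu hv := by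
    change causalVec n (anticausalVec k (u + v) ᵥ* G) = 0
    rw [map_add, Matrix.add_vecMul, map_add, show _ = _ from hu, show _ = _ from hv,
      add_zero]
  smul_mem' c u hu := by
    change causalVec n (anticausalVec k (c • u) ᵥ* G) = 0
    rw [map_smul, smul_vecMul, map_smul, show _ = _ from hu, smul_zero]

/-- The encoding state space `Σ_G`, the quotient of `F((D))^k` by the zero states,
as a vector space over `F`. -/
abbrev StateSpace (G : Matrix (Fin k) (Fin n) F⸨X⸩) : Type _ :=
  (Fin k → F⸨X⸩) ⧸ zeroStates G

end

/-- An encoder: a state space `F^m` and a linear map taking a state and an input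
to the next state and the output. -/
structure Encoder (F : Type*) [Field F] (k n : ℕ) where
  /-- The dimension of the state space. -/
  degree : ℕ
  /-- The transition and output map. -/
  step : ((Fin degree → F) × (Fin k → F)) →ₗ[F] ((Fin degree → F) × (Fin n → F))

noncomputable section

variable {F : Type*} [Field F] {k n : ℕ}

/-- `E` realizes the encoding `u ↦ u G`: on every message `u`, the run of `E` that is in the zero
state in the distant past outputs `u G`. As messages vanish in the distant past, a run
`s : ℤ → F^m` of that kind is unique. -/
def Encoder.Realizes (E : Encoder F k n) (G : Matrix (Fin k) (Fin n) F⸨X⸩) : Prop :=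
  ∀ u : Fin k → F⸨X⸩, ∃ s : ℤ → (Fin E.degree → F),
    (∃ N : ℤ, ∀ t < N, s t = 0) ∧
    ∀ t : ℤ, E.step (s t, fun i => (u i).coeff t) = (s (t + 1), fun j => ((u ᵥ* G) j).coeff t)

/-- The degrees of all encoders that realize the encoding `u ↦ u G`. -/
def encoderDegrees (G : Matrix (Fin k) (Fin n) F⸨X⸩) : Set ℕ :=
  {m | ∃ E : Encoder F k n, E.Realizes G ∧ E.degree = m}

/-- The McMillan degree: the smallest degree of an encoder realizing `u ↦ u G`. -/
def mdeg (G : Matrix (Fin k) (Fin n) F⸨X⸩) : ℕ := sInf (encoderDegrees G)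

/-- A polynomial matrix as a matrix of Laurent series. -/
def toLaurent (G : Matrix (Fin k) (Fin n) F[X]) : Matrix (Fin k) (Fin n) F⸨X⸩ :=
  G.map fun p => HahnSeries.ofPowerSeries ℤ F (p : PowerSeries F)

/-- A polynomial `k × n` matrix is generating if it has rank `k`. -/
def IsGenerating (G : Matrix (Fin k) (Fin n) F[X]) : Prop := (toLaurent G).rank = k

/-- The degree of the `i`th row, the largest degree of its entries. -/
def rowDeg (G : Matrix (Fin k) (Fin n) F[X]) (i : Fin k) : ℕ :=
  Finset.univ.sup fun j => (G i j).natDegree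

/-- The external degree, the sum of the row degrees. -/
def extdeg (G : Matrix (Fin k) (Fin n) F[X]) : ℕ := ∑ i, rowDeg G i

/-- The internal degree, the largest degree of a `k × k` minor. -/
def intdeg (G : Matrix (Fin k) (Fin n) F[X]) : ℕ :=
  Finset.univ.sup fun c : Fin k ↪o Fin n => (G.submatrix id c).det.natDegree

/-- A matrix is reduced if adding polynomial multiples of some rows to another row
cannot lower the external degree. -/
def IsReduced (G : Matrix (Fin k) (Fin n) F[X]) : Prop :=
  ∀ (i : Fin k) (c : Fin k → F[X]),
    extdeg G ≤ extdeg (G.updateRow i (G i + ∑ j ∈ Finset.univ.erase i, c j • G j))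

end

end ConvCode

/-! The proof compares everything with the dimension of `Σ_G`: intdeg ≤ mdeg = dim `Σ_G` ≤ extdeg
always holds, and extdeg ≤ intdeg holds for reduced matrices.

A state of `Σ_G` is exactly what the past input contributes to the future output. Any encoder
realizing `G` must tell these contributions apart by its state at time 0, so its degree is at least
dim `Σ_G` (`Encoder.Realizes.finrank_stateSpace_le`). Conversely, `Σ_G` itself carries a linear
transition map that realizes `G` (`canonicalEncoder_realizes`). Row `i` remembers only its last `deg
g_i` inputs, which bounds dim `Σ_G` by extdeg.

For intdeg ≤ mdeg, the state equations `S = D(SA + B)`, `G = SC + M` turn a minor of `G` times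
`det(1 - DA)` into a determinant with `D` in only as many columns as the encoder has states
(`natDegree_det_submatrix_le`).

If `G` is reduced, its leading row coefficients are independent: a dependency would let a row of
largest degree involved be lowered. Hence some minor of them is nonzero, and it is the coefficient
of `D^extdeg` in a minor of `G`. -/

namespace ConvCode

noncomputable section

variable {F : Type*} [Field F] {k n : ℕ}

/-! ### Degrees and leading coefficients of determinants -/

section Determinants

variable {R : Type*} [CommRing R]

theorem natDegree_det_le_sum {ι : Type*} [Fintype ι] [DecidableEq ι]
    (M : Matrix ι ι R[X]) (d : ι → ℕ) (h : ∀ i j, (M i j).natDegree ≤ d j) :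
    M.det.natDegree ≤ ∑ j, d j := by
  rw [Matrix.det_apply]
  refine Polynomial.natDegree_sum_le_of_forall_le _ _ fun σ _ => ?_
  refine (Polynomial.natDegree_smul_le _ _).trans ?_
  exact (Polynomial.natDegree_prod_le _ _).trans (Finset.sum_le_sum fun i _ => h _ _)

theorem coeff_prod_sum_of_natDegree_le {κ : Type*} [DecidableEq κ] (s : Finset κ) (f : κ → R[X])
    (d : κ → ℕ) (h : ∀ i ∈ s, (f i).natDegree ≤ d i) :
    (∏ i ∈ s, f i).coeff (∑ i ∈ s, d i) = ∏ i ∈ s, (f i).coeff (d i) := by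
  induction s using Finset.induction_on with
  | empty => simp
  | insert a s ha ih =>
    rw [Finset.prod_insert ha, Finset.sum_insert ha, Finset.prod_insert ha,
      Polynomial.coeff_mul_add_eq_of_natDegree_le (h a (by simp)), ih fun i hi => h i (by simp [hi])]
    exact (Polynomial.natDegree_prod_le _ _).trans
      (Finset.sum_le_sum fun i hi => h i (by simp [hi]))

/-- The determinant of the matrix of leading row coefficients is the coefficient of the
determinant in the degree `∑ i, d i`. -/
theorem coeff_det_sum_of_natDegree_le {ι : Type*} [Fintype ι] [DecidableEq ι]
    (M : Matrix ι ι R[X]) (d : ι → ℕ) (h : ∀ i j, (M i j).natDegree ≤ d i) :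
    M.det.coeff (∑ i, d i) = (Matrix.of fun i j => (M i j).coeff (d i)).det := by
  rw [← Matrix.det_transpose M, ← Matrix.det_transpose (Matrix.of _), Matrix.det_apply,
    Matrix.det_apply, Polynomial.finsetSum_coeff]
  refine Finset.sum_congr rfl fun σ _ => ?_
  rw [Polynomial.coeff_smul]
  congr 1
  exact coeff_prod_sum_of_natDegree_le _ _ _ fun i _ => h _ _

/-- A matrix over a field with linearly independent rows has a nonzero maximal minor. -/
theorem exists_det_submatrix_ne_zero (L : Matrix (Fin k) (Fin n) F)
    (h : LinearIndependent F L.row) : ∃ c : Fin k ↪o Fin n, (L.submatrix id c).det ≠ 0 := by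
  have hrank : L.rank = k := by simpa using h.rank_matrix
  have hspan : Submodule.span F (Set.range L.col) = ⊤ := by
    apply Submodule.eq_top_of_finrank_eq
    rw [← Matrix.rank_eq_finrank_span_cols, hrank]
    simp
  obtain ⟨κ, a, ha, hs, hli⟩ := exists_linearIndependent' F L.col
  rw [hspan] at hs
  have : Finite κ := Finite.of_injective a ha
  have : Fintype κ := Fintype.ofFinite κ
  have hcard : Fintype.card κ = k := by
    have := linearIndependent_iff_card_eq_finrank_span.mp hli
    rw [this, Set.finrank, hs]
    simp
  classical
  have hs' : (Finset.univ.image a).card = k := by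
    rw [Finset.card_image_of_injective _ ha, Finset.card_univ, hcard]
  refine ⟨(Finset.univ.image a).orderEmbOfFin hs', ?_⟩
  -- The minor takes the chosen columns in increasing order, whereas `a` enumerates them
  -- arbitrarily; `f` translates between the two.
  have hmem : ∀ i, ∃ x, a x = (Finset.univ.image a).orderEmbOfFin hs' i := fun i => by
    obtain ⟨x, -, hx⟩ := Finset.mem_image.mp (Finset.orderEmbOfFin_mem _ hs' i)
    exact ⟨x, hx⟩
  choose f hf using hmem
  have hfi : Function.Injective f := fun x y hxy =>
    ((Finset.univ.image a).orderEmbOfFin hs').injective (by rw [← hf, ← hf, hxy])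
  have hli' := hli.comp f hfi
  have : L.col ∘ a ∘ f = (L.submatrix id ((Finset.univ.image a).orderEmbOfFin hs')).col := by
    ext i j
    exact congrArg (L j) (hf i)
  rw [Function.comp_assoc, this, Matrix.linearIndependent_cols_iff_isUnit,
    Matrix.isUnit_iff_isUnit_det] at hli'
  exact hli'.ne_zero

end Determinants

/-! ### Generating matrices, reduced matrices and row degrees -/

theorem natDegree_le_rowDeg (G : Matrix (Fin k) (Fin n) F[X]) (i : Fin k) (j : Fin n) :
    (G i j).natDegree ≤ rowDeg G i :=
  Finset.le_sup (f := fun j => (G i j).natDegree) (Finset.mem_univ j)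

/-- The embedding of the polynomials into the Laurent series. -/
def polyToLaurent (F : Type*) [Field F] : F[X] →+* F⸨X⸩ :=
  (HahnSeries.ofPowerSeries ℤ F).comp Polynomial.coeToPowerSeries.ringHom

theorem polyToLaurent_injective : Function.Injective (polyToLaurent F) :=
  HahnSeries.ofPowerSeries_injective.comp (Polynomial.coe_injective F)

theorem toLaurent_apply (G : Matrix (Fin k) (Fin n) F[X]) (i : Fin k) (j : Fin n) :
    toLaurent G i j = polyToLaurent F (G i j) := rfl

theorem vecMul_toLaurent_injective {G : Matrix (Fin k) (Fin n) F[X]}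
    (hG : IsGenerating G) : Function.Injective (toLaurent G).vecMul := by
  rw [Matrix.vecMul_injective_iff, linearIndependent_iff_card_eq_finrank_span, Set.finrank]
  have := (toLaurent G).rank_eq_finrank_span_row
  rw [hG] at this
  rw [← this, Fintype.card_fin]

/-- The rows of a generating matrix are linearly independent over the constants. -/
theorem eq_zero_of_sum_C_mul_eq_zero {G : Matrix (Fin k) (Fin n) F[X]} (hG : IsGenerating G)
    (a : Fin k → F) (h : ∀ j, ∑ i, Polynomial.C (a i) * G i j = 0) : a = 0 := by
  have h0 : (fun i => polyToLaurent F (Polynomial.C (a i))) = 0 := by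
    refine vecMul_toLaurent_injective hG ?_
    ext1 j
    have := congrArg (polyToLaurent F) (h j)
    rw [map_sum, map_zero] at this
    simp_rw [map_mul] at this
    simp only [Matrix.zero_vecMul, Pi.zero_apply]
    exact this
  ext i
  have := congrFun h0 i
  simpa using polyToLaurent_injective (this.trans (map_zero _).symm)

/-- The matrix of the leading coefficients of the rows. -/
def leadingRowCoeffs (G : Matrix (Fin k) (Fin n) F[X]) : Matrix (Fin k) (Fin n) F :=
  Matrix.of fun i j => (G i j).coeff (rowDeg G i)

/-- The leading row coefficients of a reduced generating matrix are linearly independent. -/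
theorem linearIndependent_leadingRowCoeffs {G : Matrix (Fin k) (Fin n) F[X]}
    (hG : IsGenerating G) (hred : IsReduced G) :
    LinearIndependent F (leadingRowCoeffs G).row := by
  classical
  rw [Fintype.linearIndependent_iff]
  by_contra! ⟨a, ha, i₀, hi₀⟩
  obtain ⟨i, hi, hmax⟩ := (Finset.univ.filter fun i => a i ≠ 0).exists_max_image (rowDeg G)
    ⟨i₀, by simpa using hi₀⟩
  simp only [Finset.mem_filter, Finset.mem_univ, true_and] at hi hmax
  have hlead (j : Fin n) : ∑ l, a l * (G l j).coeff (rowDeg G l) = 0 := by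
    simpa [leadingRowCoeffs, Matrix.row] using congrFun ha j
  -- A row of degree 0 cannot be lowered, as the zero row also has degree 0. In that case all rows
  -- involved are constant, and the dependency contradicts the rank.
  rcases Nat.eq_zero_or_pos (rowDeg G i) with h0 | hpos
  · refine hi (congrFun (eq_zero_of_sum_C_mul_eq_zero hG a fun j => ?_) i)
    have hC : ∀ l, Polynomial.C (a l) * G l j
        = Polynomial.C (a l * (G l j).coeff (rowDeg G l)) := fun l => by
      by_cases hl : a l = 0
      · simp [hl]
      · have hl0 : rowDeg G l = 0 := Nat.le_zero.mp (h0 ▸ hmax l hl)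
        have := natDegree_le_rowDeg G l j
        rw [hl0] at this ⊢
        rw [Polynomial.C_mul, ← Polynomial.eq_C_of_natDegree_le_zero this]
    simp_rw [hC]
    rw [← map_sum, hlead, map_zero]
  -- The powers of `D` align the leading terms in degree `rowDeg G i`, and the division gives `c i =
  -- 1`. Truncated subtraction is harmless: rows of larger degree have `a l = 0`.
  · set c : Fin k → F[X] := fun l =>
      Polynomial.C (a l / a i) * Polynomial.X ^ (rowDeg G i - rowDeg G l) with hc
    set r := G i + ∑ l ∈ Finset.univ.erase i, c l • G l with hr
    have hsum : r = ∑ l, c l • G l := by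
      rw [← Finset.add_sum_erase _ _ (Finset.mem_univ i)]
      simp [hr, hc, hi]
    have hterm (l : Fin k) (j : Fin n) : (c l * G l j).natDegree ≤ rowDeg G i ∧
        (c l * G l j).coeff (rowDeg G i) = a l / a i * (G l j).coeff (rowDeg G l) := by
      by_cases hl : a l = 0
      · simp [hc, hl]
      · have hle := hmax l hl
        have hd := natDegree_le_rowDeg G l j
        have hcd : (c l).natDegree ≤ rowDeg G i - rowDeg G l :=
          Polynomial.natDegree_C_mul_X_pow_le _ _
        constructor
        · exact Polynomial.natDegree_mul_le.trans (by omega)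
        · have := Polynomial.coeff_mul_add_eq_of_natDegree_le hcd hd
          rw [Nat.sub_add_cancel hle] at this
          rw [this]
          simp [hc]
    have hdeg (j : Fin n) : (r j).natDegree < rowDeg G i := by
      have hrj : r j = ∑ l, c l * G l j := by simp [hsum, Finset.sum_apply]
      have hle : (r j).natDegree ≤ rowDeg G i := by
        rw [hrj]
        exact Polynomial.natDegree_sum_le_of_forall_le _ _ fun l _ => (hterm l j).1
      refine lt_of_le_of_ne hle fun heq => ?_
      have hz : (r j).coeff (rowDeg G i) = 0 := by
        rw [hrj, Polynomial.finsetSum_coeff]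
        simp_rw [fun l => (hterm l j).2, div_mul_eq_mul_div]
        rw [← Finset.sum_div, hlead, zero_div]
      rw [← heq, Polynomial.coeff_natDegree, Polynomial.leadingCoeff_eq_zero] at hz
      rw [hz] at heq
      simp at heq
      omega
    have hlt : extdeg (G.updateRow i r) < extdeg G := by
      refine Finset.sum_lt_sum (fun l _ => ?_) ⟨i, Finset.mem_univ i, ?_⟩
      · by_cases hl : l = i
        · subst hl
          refine Finset.sup_le fun j _ => ?_
          simpa using (hdeg j).le
        · simp [rowDeg, Matrix.updateRow_ne hl]
      · refine (Finset.sup_lt_iff hpos).mpr fun j _ => ?_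
        simpa using hdeg j
    exact absurd (hred i c) (not_le.mpr hlt)

/-- Some maximal minor of the leading row coefficients is nonzero, and it is the coefficient in
degree `extdeg G` of the same minor of `G`. -/
theorem extdeg_le_intdeg_of_isReduced {G : Matrix (Fin k) (Fin n) F[X]}
    (hG : IsGenerating G) (hred : IsReduced G) : extdeg G ≤ intdeg G := by
  obtain ⟨c, hc⟩ := exists_det_submatrix_ne_zero _ (linearIndependent_leadingRowCoeffs hG hred)
  have hle : (G.submatrix id c).det.natDegree ≤ intdeg G :=
    Finset.le_sup (f := fun c : Fin k ↪o Fin n => (G.submatrix id c).det.natDegree)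
      (Finset.mem_univ c)
  refine le_trans (Polynomial.le_natDegree_of_ne_zero ?_) hle
  rw [extdeg, coeff_det_sum_of_natDegree_le (G.submatrix id c) _
    fun i j => natDegree_le_rowDeg G i (c j)]
  exact hc

/-! ### Coefficients of products, and membership in the zero states -/

theorem coeff_mul_eq_zero {f g : F⸨X⸩} {t : ℤ}
    (h : ∀ i j, i + j = t → f.coeff i = 0 ∨ g.coeff j = 0) : (f * g).coeff t = 0 := by
  rw [HahnSeries.coeff_mul]
  refine Finset.sum_eq_zero fun p hp => ?_
  rw [mul_eq_zero]
  exact h _ _ (Finset.mem_antidiagonal.mp hp).2.2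

theorem coeff_vecMul (u : Fin k → F⸨X⸩) (G : Matrix (Fin k) (Fin n) F⸨X⸩) (j : Fin n) (t : ℤ) :
    ((u ᵥ* G) j).coeff t = ∑ i, (u i * G i j).coeff t := by
  simp only [Matrix.vecMul, dotProduct]
  exact HahnSeries.coeff_sum _

theorem coeff_vecMul_eq_zero {u : Fin k → F⸨X⸩} {G : Matrix (Fin k) (Fin n) F⸨X⸩} {j : Fin n}
    {t : ℤ} (h : ∀ i r s, r + s = t → (u i).coeff r = 0 ∨ (G i j).coeff s = 0) :
    ((u ᵥ* G) j).coeff t = 0 := by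
  rw [coeff_vecMul]
  exact Finset.sum_eq_zero fun i _ => coeff_mul_eq_zero (h i)

theorem coeff_polyToLaurent (p : F[X]) (t : ℕ) : (polyToLaurent F p).coeff t = p.coeff t := by
  simp [polyToLaurent]

theorem coeff_polyToLaurent_of_neg (p : F[X]) {t : ℤ} (ht : t < 0) :
    (polyToLaurent F p).coeff t = 0 := by
  rw [show polyToLaurent F p = HahnSeries.ofPowerSeries ℤ F (p : PowerSeries F) from rfl,
    PowerSeries.coeff_coe, if_pos ht]

theorem coeff_polyToLaurent_of_natDegree_lt (p : F[X]) {t : ℤ} (ht : p.natDegree < t) :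
    (polyToLaurent F p).coeff t = 0 := by
  lift t to ℕ using by omega
  rw [coeff_polyToLaurent, Polynomial.coeff_eq_zero_of_natDegree_lt (by omega)]

theorem mem_zeroStates_iff {G : Matrix (Fin k) (Fin n) F⸨X⸩} {u : Fin k → F⸨X⸩} :
    u ∈ zeroStates G ↔ ∀ j, ∀ t : ℕ, ((anticausalVec k u ᵥ* G) j).coeff (t : ℤ) = 0 := by
  change causalVec n (anticausalVec k u ᵥ* G) = 0 ↔ _
  constructor
  · intro h j t
    have := congrArg (fun f : F⸨X⸩ => f.coeff (t : ℤ)) (congrFun h j)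
    have h2 := causal_coeff ((anticausalVec k u ᵥ* G) j) (t : ℤ)
    rw [if_neg (by omega)] at h2
    rw [← h2]
    exact this
  · intro h
    ext j t
    refine (causal_coeff _ _).trans ?_
    split_ifs with ht
    · rfl
    · lift t to ℕ using by omega
      exact h j t

theorem mem_zeroStates_of_coeff_neg {G : Matrix (Fin k) (Fin n) F⸨X⸩} {u : Fin k → F⸨X⸩}
    (h : ∀ i, ∀ t < 0, (u i).coeff t = 0) : u ∈ zeroStates G := by
  have : anticausalVec k u = 0 := by
    ext i t
    refine (anticausal_coeff _ _).trans ?_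
    split_ifs with ht
    · exact h i t ht
    · rfl
  rw [mem_zeroStates_iff, this]
  simp

/-! ### The state space has dimension at most the external degree -/

/-- The last `rowDeg G i` coefficients of negative exponent in each component `i`. -/
def recentInputs (G : Matrix (Fin k) (Fin n) F[X]) :
    (Fin k → F⸨X⸩) →ₗ[F] ((Σ i : Fin k, Fin (rowDeg G i)) → F) where
  toFun u x := (u x.1).coeff (-1 - (x.2 : ℤ))
  map_add' _ _ := rfl
  map_smul' _ _ := rfl

/-- An input at time `r < 0` reaches a time `t ≥ 0` only through a coefficient of `g_i` of exponent
`t - r ≥ -r`, so only the times from `-deg g_i` to `-1` matter. -/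
theorem ker_recentInputs_le (G : Matrix (Fin k) (Fin n) F[X]) :
    LinearMap.ker (recentInputs G) ≤ zeroStates (toLaurent G) := by
  intro u hu
  rw [mem_zeroStates_iff]
  refine fun j t => coeff_vecMul_eq_zero fun i r s hrs => ?_
  rw [toLaurent_apply]
  by_cases hs : (G i j).natDegree < s
  · exact Or.inr (coeff_polyToLaurent_of_natDegree_lt _ hs)
  · left
    refine (anticausal_coeff _ _).trans ?_
    split_ifs with hr
    · have hle := natDegree_le_rowDeg G i j
      have := congrFun hu ⟨i, ⟨(-1 - r).toNat, by omega⟩⟩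
      simp only [recentInputs, LinearMap.coe_mk, AddHom.coe_mk, Pi.zero_apply] at this
      rwa [show -1 - (((-1 - r).toNat : ℕ) : ℤ) = r by omega] at this
    · rfl

theorem finite_stateSpace_and_finrank_le_extdeg (G : Matrix (Fin k) (Fin n) F[X]) :
    Module.Finite F (StateSpace (toLaurent G)) ∧
      Module.finrank F (StateSpace (toLaurent G)) ≤ extdeg G := by
  have hfin : Module.Finite F ((Fin k → F⸨X⸩) ⧸ LinearMap.ker (recentInputs G)) :=
    Module.Finite.equiv (recentInputs G).quotKerEquivRange.symm
  have hsurj := Submodule.factor_surjective (ker_recentInputs_le G)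
  refine ⟨Module.Finite.of_surjective _ hsurj, ?_⟩
  calc Module.finrank F (StateSpace (toLaurent G))
      ≤ Module.finrank F ((Fin k → F⸨X⸩) ⧸ LinearMap.ker (recentInputs G)) :=
        LinearMap.finrank_le_finrank_of_surjective hsurj
    _ = Module.finrank F (LinearMap.range (recentInputs G)) :=
        (recentInputs G).quotKerEquivRange.finrank_eq
    _ ≤ Module.finrank F ((Σ i : Fin k, Fin (rowDeg G i)) → F) := Submodule.finrank_le _
    _ = extdeg G := by simp [extdeg]

/-! ### Every encoder has degree at least the dimension of the state space -/

/-- The output of an encoder at time `t` when it is started in the state `s` and receives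
the zero input. -/
def Encoder.freeOutput (E : Encoder F k n) :
    (Fin E.degree → F) →ₗ[F] (ℕ → Fin n → F) :=
  LinearMap.pi fun t => LinearMap.snd F _ _ ∘ₗ E.step ∘ₗ LinearMap.inl F _ _ ∘ₗ
    (LinearMap.fst F _ _ ∘ₗ E.step ∘ₗ LinearMap.inl F _ _) ^ t

/-- The map `u ↦ K(Z(u) G)`, as a map to sequences of coefficients. -/
def futureOutput (G : Matrix (Fin k) (Fin n) F⸨X⸩) :
    (Fin k → F⸨X⸩) →ₗ[F] (ℕ → Fin n → F) where
  toFun u t j := ((anticausalVec k u ᵥ* G) j).coeff (t : ℤ)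
  map_add' u v := by
    ext t j
    rw [map_add, Matrix.add_vecMul]
    rfl
  map_smul' c u := by
    ext t j
    rw [map_smul, smul_vecMul]
    rfl

theorem ker_futureOutput (G : Matrix (Fin k) (Fin n) F⸨X⸩) :
    LinearMap.ker (futureOutput G) = zeroStates G := by
  ext u
  rw [mem_zeroStates_iff, LinearMap.mem_ker]
  exact ⟨fun h j t => congrFun (congrFun h t) j, fun h => by ext t j; exact h j t⟩

/-- On the input `Z(u)` the encoder receives zeros from time 0 on, so its output from then on is
determined by the state `s 0` alone. -/
theorem Encoder.Realizes.range_futureOutput_le {E : Encoder F k n}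
    {G : Matrix (Fin k) (Fin n) F⸨X⸩} (h : E.Realizes G) :
    LinearMap.range (futureOutput G) ≤ LinearMap.range E.freeOutput := by
  rintro _ ⟨u, rfl⟩
  obtain ⟨s, -, hs⟩ := h (anticausalVec k u)
  have hin (t : ℕ) : (fun i => (anticausalVec k u i).coeff (t : ℤ)) = 0 := by
    ext i
    exact (anticausal_coeff _ _).trans (if_neg (by omega))
  have hpow (t : ℕ) : ((LinearMap.fst F _ _ ∘ₗ E.step ∘ₗ LinearMap.inl F _ _) ^ t) (s 0)
      = s (t : ℤ) := by
    induction t with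
    | zero => simp
    | succ t ih =>
      rw [pow_succ', Module.End.mul_apply, ih]
      have := hs t
      rw [hin] at this
      simp [this]
  refine ⟨s 0, ?_⟩
  ext t j
  have := hs t
  rw [hin] at this
  simp only [freeOutput, LinearMap.pi_apply, LinearMap.comp_apply, hpow, LinearMap.inl_apply,
    LinearMap.snd_apply, this]
  rfl

theorem Encoder.Realizes.finrank_stateSpace_le {E : Encoder F k n}
    {G : Matrix (Fin k) (Fin n) F⸨X⸩} (h : E.Realizes G) :
    Module.finrank F (StateSpace G) ≤ E.degree := by
  calc Module.finrank F (StateSpace G)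
      = Module.finrank F (LinearMap.range (futureOutput G)) := by
        rw [← (futureOutput G).quotKerEquivRange.finrank_eq]
        exact (Submodule.quotEquivOfEq _ _ (ker_futureOutput G)).symm.finrank_eq
    _ ≤ Module.finrank F (LinearMap.range E.freeOutput) :=
        Submodule.finrank_mono h.range_futureOutput_le
    _ ≤ Module.finrank F (Fin E.degree → F) := LinearMap.finrank_range_le _
    _ = E.degree := by simp

/-! ### The degree of an encoder bounds the degrees of the minors -/

/-- A matrix of constants as a matrix of Laurent series. -/
def constMatrix {p q : ℕ} (P : Matrix (Fin p) (Fin q) F) : Matrix (Fin p) (Fin q) F⸨X⸩ :=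
  P.map HahnSeries.C

theorem constMatrix_apply {p q : ℕ} (P : Matrix (Fin p) (Fin q) F) (i : Fin p) (j : Fin q) :
    constMatrix P i j = HahnSeries.C (P i j) := rfl

/-- In a realization with transition matrices `A`, `B`, `C`, `M`, the Laurent series of the states
on the unit inputs solve the state equations. -/
theorem Encoder.Realizes.exists_state_matrices {E : Encoder F k n}
    {G : Matrix (Fin k) (Fin n) F⸨X⸩} (h : E.Realizes G) :
    ∃ (A : Matrix (Fin E.degree) (Fin E.degree) F) (B : Matrix (Fin k) (Fin E.degree) F)
      (C : Matrix (Fin E.degree) (Fin n) F) (M : Matrix (Fin k) (Fin n) F)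
      (S : Matrix (Fin k) (Fin E.degree) F⸨X⸩),
      S = (HahnSeries.single (1 : ℤ) (1 : F) : F⸨X⸩) •
        (S * constMatrix A + constMatrix B) ∧
      G = S * constMatrix C + constMatrix M := by
  choose s hs0 hs using fun i : Fin k => h (Pi.single i 1)
  choose N hN using hs0
  let A : Matrix (Fin E.degree) (Fin E.degree) F := .of fun i => (E.step (Pi.single i 1, 0)).1
  let B : Matrix (Fin k) (Fin E.degree) F := .of fun i => (E.step (0, Pi.single i 1)).1
  let C : Matrix (Fin E.degree) (Fin n) F := .of fun i => (E.step (Pi.single i 1, 0)).2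
  let M : Matrix (Fin k) (Fin n) F := .of fun i => (E.step (0, Pi.single i 1)).2
  have hstep (x : Fin E.degree → F) (y : Fin k → F) :
      E.step (x, y) = (x ᵥ* A + y ᵥ* B, x ᵥ* C + y ᵥ* M) := by
    have hx : ((x, y) : (Fin E.degree → F) × (Fin k → F)) =
        ∑ i, x i • (Pi.single i 1, 0) + ∑ i, y i • (0, Pi.single i 1) := by
      ext i
      · simp [Prod.fst_sum, Finset.sum_apply, Pi.single_apply]
      · simp [Prod.snd_sum, Finset.sum_apply, Pi.single_apply]
    rw [hx, map_add, map_sum, map_sum]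
    simp only [map_smul]
    ext j
    · simp [Prod.fst_sum, Finset.sum_apply, A, B, Matrix.vecMul, dotProduct]
    · simp [Prod.snd_sum, Finset.sum_apply, C, M, Matrix.vecMul, dotProduct]
  -- Vanishing in the distant past is what makes the state sequences Laurent series.
  have hbdd (i : Fin k) (l : Fin E.degree) : BddBelow (Function.support fun t => s i t l) :=
    ⟨N i, fun t ht => not_lt.mp fun hlt => ht (by simp [hN i t hlt])⟩
  let S : Matrix (Fin k) (Fin E.degree) F⸨X⸩ :=
    .of fun i l => HahnSeries.ofSuppBddBelow (fun t => s i t l) (hbdd i l)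
  have hmul {q : ℕ} (P : Matrix (Fin E.degree) (Fin q) F) (i : Fin k) (j : Fin q) (t : ℤ) :
      ((S * constMatrix P) i j).coeff t = (s i t ᵥ* P) j := by
    rw [Matrix.mul_apply, HahnSeries.coeff_sum]
    refine Finset.sum_congr rfl fun l _ => ?_
    rw [constMatrix_apply, HahnSeries.C_apply, HahnSeries.coeff_mul_single_zero]
    rfl
  have hunit {q : ℕ} (P : Matrix (Fin k) (Fin q) F) (i : Fin k) (j : Fin q) (t : ℤ) :
      (constMatrix P i j).coeff t =
        ((fun l => ((Pi.single i 1 : Fin k → F⸨X⸩) l).coeff t) ᵥ* P) j := by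
    rw [Matrix.vecMul, dotProduct, Finset.sum_eq_single i]
    · simp only [Pi.single_eq_same, constMatrix_apply, HahnSeries.C_apply, HahnSeries.coeff_one,
        HahnSeries.coeff_single]
      split_ifs <;> simp
    · intro l _ hl
      simp [Pi.single_eq_of_ne hl]
    · simp
  refine ⟨A, B, C, M, S, ?_, ?_⟩
  · ext i l t
    -- The factor `D` matches the delay: the state at time `t` comes from the transition at `t - 1`.
    have := congrFun (congrArg Prod.fst (hs i (t - 1))) l
    rw [hstep] at this
    rw [Matrix.smul_apply, smul_eq_mul, HahnSeries.coeff_single_mul, one_mul, Matrix.add_apply,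
      HahnSeries.coeff_add, hmul, hunit]
    refine Eq.trans ?_ this.symm
    rw [sub_add_cancel]
    rfl
  · ext i j t
    have := congrFun (congrArg Prod.snd (hs i t)) j
    rw [hstep, Matrix.single_one_vecMul] at this
    rw [Matrix.add_apply, HahnSeries.coeff_add, hmul, hunit]
    exact this.symm

/-- With `C`, `M`, `G` restricted to the columns `c`, let `Q` have the block rows `(1 - DA, C)` and
`(-DB, M)`. Adding `S` times the first to the second gives `(0, G)`, because `S(1 - DA) = DB`. Thus
`det Q` is `det(1 - DA)` times the minor, and `D` occurs only in the first `E.degree` columns of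
`Q`. -/
theorem natDegree_det_submatrix_le {G : Matrix (Fin k) (Fin n) F[X]} {E : Encoder F k n}
    (h : E.Realizes (toLaurent G)) (c : Fin k → Fin n) :
    (G.submatrix id c).det.natDegree ≤ E.degree := by
  obtain ⟨A, B, C, M, S, hS, hG⟩ := h.exists_state_matrices
  by_cases hdet : (G.submatrix id c).det = 0
  · simp [hdet]
  let T : Matrix (Fin E.degree) (Fin E.degree) F[X] :=
    (Polynomial.X : F[X]) • (-A).map Polynomial.C + (1 : Matrix _ _ F).map Polynomial.C
  let Q : Matrix (Fin E.degree ⊕ Fin k) (Fin E.degree ⊕ Fin k) F[X] :=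
    Matrix.fromBlocks T ((C.submatrix id c).map Polynomial.C)
      ((Polynomial.X : F[X]) • (-B).map Polynomial.C) ((M.submatrix id c).map Polynomial.C)
  -- The constant coefficient of `det(1 - DA)` is 1.
  have hT : T.det ≠ 0 := fun h0 => by
    have := Polynomial.coeff_det_X_add_C_zero (-A) 1
    rw [show (Polynomial.X : F[X]) • (-A).map Polynomial.C + (1 : Matrix _ _ F).map Polynomial.C
      = T from rfl, h0] at this
    simp at this
  have hQ : Q.det = T.det * (G.submatrix id c).det := by
    apply polyToLaurent_injective
    rw [map_mul, RingHom.map_det, RingHom.map_det, RingHom.map_det]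
    have hX : polyToLaurent F Polynomial.X = HahnSeries.single 1 1 := by
      simp [polyToLaurent]
    have hC (a : F) : polyToLaurent F (Polynomial.C a) = HahnSeries.C a := by
      simp [polyToLaurent]
    have hblock : Matrix.fromBlocks 1 0 S 1 * (polyToLaurent F).mapMatrix Q
        = Matrix.fromBlocks ((polyToLaurent F).mapMatrix T)
          (constMatrix (C.submatrix id c)) 0
          ((polyToLaurent F).mapMatrix (G.submatrix id c)) := by
      have hTm : (polyToLaurent F).mapMatrix T = 1 -
          (HahnSeries.single (1 : ℤ) (1 : F) : F⸨X⸩) • constMatrix A := by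
        ext1 i j
        simp [T, hX, hC, constMatrix_apply, Matrix.one_apply, sub_eq_neg_add]
      have hBm : ((Polynomial.X : F[X]) • (-B).map Polynomial.C).map (polyToLaurent F) =
          -((HahnSeries.single (1 : ℤ) (1 : F) : F⸨X⸩) • constMatrix B) := by
        ext1 i j
        simp [hX, hC, constMatrix_apply]
      have hCm {p q : ℕ} (P : Matrix (Fin p) (Fin q) F) :
          (P.map Polynomial.C).map (polyToLaurent F) = constMatrix P := by
        ext1 i j
        simp [hC, constMatrix_apply]
      rw [RingHom.mapMatrix_apply, Matrix.fromBlocks_map, Matrix.fromBlocks_multiply, hBm, hCm,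
        hCm, ← RingHom.mapMatrix_apply, Matrix.one_mul, Matrix.one_mul, Matrix.one_mul,
        Matrix.one_mul, Matrix.zero_mul, Matrix.zero_mul, add_zero, add_zero]
      congr 1
      · rw [hTm, Matrix.mul_sub, Matrix.mul_one, Matrix.mul_smul]
        nth_rw 1 [hS]
        rw [smul_add]
        abel
      · ext1 i j
        exact (congrFun (congrFun hG i) (c j)).symm
    have := congrArg Matrix.det hblock
    rw [Matrix.det_mul, Matrix.det_fromBlocks_zero₁₂, Matrix.det_fromBlocks_zero₂₁] at this
    simpa using this
  have hle : Q.det.natDegree ≤ E.degree := by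
    refine (natDegree_det_le_sum Q (Sum.elim (fun _ => 1) fun _ => 0) ?_).trans ?_
    · rintro (i | i) (j | j)
      · simp only [Q, T, Matrix.fromBlocks_apply₁₁, Matrix.add_apply, Matrix.smul_apply,
          Matrix.map_apply, smul_eq_mul, Sum.elim_inl]
        compute_degree
      · simp [Q]
      · simp only [Q, Matrix.fromBlocks_apply₂₁, Matrix.smul_apply,
          Matrix.map_apply, smul_eq_mul, Sum.elim_inl]
        compute_degree
      · simp [Q]
    · simp
  rw [hQ, Polynomial.natDegree_mul hT hdet] at hle
  omega

theorem intdeg_le_degree {G : Matrix (Fin k) (Fin n) F[X]} {E : Encoder F k n}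
    (h : E.Realizes (toLaurent G)) : intdeg G ≤ E.degree :=
  Finset.sup_le fun c _ => natDegree_det_submatrix_le h c

/-! ### The canonical encoder on the state space -/

/-- Multiplication by `D ^ (-t)`: the coefficient at `t` moves to the exponent `0`. -/
def shiftVec (k : ℕ) (t : ℤ) : (Fin k → F⸨X⸩) →ₗ[F] (Fin k → F⸨X⸩) where
  toFun u i := HahnSeries.single (-t) (1 : F) * u i
  map_add' u v := by
    ext1 i
    exact mul_add _ _ _
  map_smul' c u := by
    ext i r
    change (HahnSeries.single (-t) (1 : F) * (c • u i)).coeff r =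
      c * (HahnSeries.single (-t) (1 : F) * u i).coeff r
    rw [HahnSeries.coeff_single_mul, HahnSeries.coeff_single_mul, one_mul, one_mul]
    rfl

theorem shiftVec_coeff (t : ℤ) (u : Fin k → F⸨X⸩) (i : Fin k) (r : ℤ) :
    (shiftVec k t u i).coeff r = (u i).coeff (r + t) := by
  refine (HahnSeries.coeff_single_mul (b := -t)).trans ?_
  rw [one_mul, sub_neg_eq_add]

theorem shiftVec_vecMul (t : ℤ) (u : Fin k → F⸨X⸩) (G : Matrix (Fin k) (Fin n) F⸨X⸩) :
    shiftVec k t u ᵥ* G = shiftVec n t (u ᵥ* G) :=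
  Matrix.smul_vecMul (HahnSeries.single (-t) (1 : F) : F⸨X⸩) u G

/-- Vectors of constants as vectors of Laurent series. -/
def constVec (k : ℕ) : (Fin k → F) →ₗ[F] (Fin k → F⸨X⸩) where
  toFun a i := HahnSeries.C (a i)
  map_add' a b := by
    ext1 i
    exact map_add _ _ _
  map_smul' c a := by
    ext1 i
    exact (map_mul _ _ _).trans HahnSeries.C_mul_eq_smul

theorem constVec_coeff (a : Fin k → F) (i : Fin k) (t : ℤ) :
    (constVec k a i).coeff t = if t = 0 then a i else 0 := by
  refine HahnSeries.coeff_single.trans ?_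
  congr

theorem anticausalVec_coeff (u : Fin k → F⸨X⸩) (i : Fin k) (t : ℤ) :
    (anticausalVec k u i).coeff t = if t < 0 then (u i).coeff t else 0 :=
  anticausal_coeff _ _

/-- The coefficient of exponent `0` of `u G`. -/
def outputAtZero (G : Matrix (Fin k) (Fin n) F⸨X⸩) : (Fin k → F⸨X⸩) →ₗ[F] (Fin n → F) where
  toFun u j := ((u ᵥ* G) j).coeff 0
  map_add' u v := by
    rw [Matrix.add_vecMul]
    rfl
  map_smul' c u := by
    rw [smul_vecMul]
    rfl

theorem zeroStates_le_ker_output (G : Matrix (Fin k) (Fin n) F⸨X⸩) :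
    zeroStates G ≤ LinearMap.ker (outputAtZero G ∘ₗ anticausalVec k) := by
  intro u hu
  rw [LinearMap.mem_ker]
  ext j
  exact mem_zeroStates_iff.mp hu j 0

/-- Makes the transition well defined on classes: dividing by `D` keeps `Z(u)` anticausal, and the
future output merely loses its first term. -/
theorem zeroStates_le_ker_shift (G : Matrix (Fin k) (Fin n) F⸨X⸩) :
    zeroStates G ≤
      LinearMap.ker ((zeroStates G).mkQ ∘ₗ shiftVec k 1 ∘ₗ anticausalVec k) := by
  intro u hu
  rw [LinearMap.mem_ker]
  refine (Submodule.Quotient.mk_eq_zero _).mpr ?_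
  rw [mem_zeroStates_iff] at hu ⊢
  intro j t
  have : anticausalVec k ((shiftVec k 1 ∘ₗ anticausalVec k) u)
      = shiftVec k 1 (anticausalVec k u) := by
    ext i r
    rw [anticausalVec_coeff, LinearMap.comp_apply, shiftVec_coeff, anticausalVec_coeff]
    split_ifs <;> first | rfl | omega
  rw [this, shiftVec_vecMul, shiftVec_coeff]
  exact_mod_cast hu j (t + 1)

/-- The transition map on the state space: the state of `u` with the input `a` goes to the state
of `D⁻¹ (Z(u) + a)`, and the output is the constant coefficient of `(Z(u) + a) G`. -/
def stateStep (G : Matrix (Fin k) (Fin n) F⸨X⸩) :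
    (StateSpace G × (Fin k → F)) →ₗ[F] (StateSpace G × (Fin n → F)) :=
  LinearMap.prod
    (LinearMap.coprod ((zeroStates G).liftQ _ (zeroStates_le_ker_shift G))
      ((zeroStates G).mkQ ∘ₗ shiftVec k 1 ∘ₗ constVec k))
    (LinearMap.coprod ((zeroStates G).liftQ _ (zeroStates_le_ker_output G))
      (outputAtZero G ∘ₗ constVec k))

theorem stateStep_mk (G : Matrix (Fin k) (Fin n) F⸨X⸩) (u : Fin k → F⸨X⸩) (a : Fin k → F) :
    stateStep G ((zeroStates G).mkQ u, a) =
      ((zeroStates G).mkQ (shiftVec k 1 (anticausalVec k u + constVec k a)),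
        outputAtZero G (anticausalVec k u + constVec k a)) := by
  simp [stateStep]

/-- The canonical encoder for `G`, after a choice of coordinates on the state space. -/
def canonicalEncoder (G : Matrix (Fin k) (Fin n) F⸨X⸩) [Module.Finite F (StateSpace G)] :
    Encoder F k n where
  degree := Module.finrank F (StateSpace G)
  step :=
    let e := (Module.finBasis F (StateSpace G)).equivFun
    (e.toLinearMap.prodMap LinearMap.id) ∘ₗ stateStep G ∘ₗ
      (e.symm.toLinearMap.prodMap LinearMap.id)

/-- The canonical encoder realizes every causal matrix. -/
theorem canonicalEncoder_realizes (G : Matrix (Fin k) (Fin n) F⸨X⸩)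
    [Module.Finite F (StateSpace G)] (hG : ∀ i j, ∀ t < 0, (G i j).coeff t = 0) :
    (canonicalEncoder G).Realizes G := by
  intro u
  let e := (Module.finBasis F (StateSpace G)).equivFun
  have hord : ∃ N : ℤ, ∀ i, ∀ t < N, (u i).coeff t = 0 := by
    obtain ⟨N, hN⟩ := (Set.finite_range fun i => (u i).order).bddBelow
    exact ⟨N, fun i t ht => HahnSeries.coeff_eq_zero_of_lt_order
      (ht.trans_le (hN (Set.mem_range_self i)))⟩
  obtain ⟨N, hN⟩ := hord
  -- The state at time `t` is the class of `D^(-t) u`, which records the inputs before `t`.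
  refine ⟨fun t => e ((zeroStates G).mkQ (shiftVec k t u)), ⟨N, fun t ht => ?_⟩, fun t => ?_⟩
  · have : (zeroStates G).mkQ (shiftVec k t u) = 0 := by
      refine (Submodule.Quotient.mk_eq_zero _).mpr
        (mem_zeroStates_of_coeff_neg fun i r hr => ?_)
      rw [shiftVec_coeff]
      exact hN i _ (by omega)
    exact (congrArg e this).trans (map_zero e)
  · have hstep : (canonicalEncoder G).step
        (e ((zeroStates G).mkQ (shiftVec k t u)), fun i => (u i).coeff t) =
        (e (stateStep G ((zeroStates G).mkQ (shiftVec k t u), fun i => (u i).coeff t)).1,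
          (stateStep G ((zeroStates G).mkQ (shiftVec k t u), fun i => (u i).coeff t)).2) := by
      change (e (stateStep G (e.symm (e _), _)).1, (stateStep G (e.symm (e _), _)).2) = _
      rw [e.symm_apply_apply]
      rfl
    refine hstep.trans ?_
    rw [stateStep_mk]
    -- `w` is `D^(-t) u` cut off after exponent 0. The cut part changes neither the next state nor,
    -- as `G` is causal, the output at time `t`.
    set w := anticausalVec k (shiftVec k t u) + constVec k fun i => (u i).coeff t with hw
    have hwc (i : Fin k) (r : ℤ) (hr : r ≤ 0) : (w i).coeff r = (u i).coeff (r + t) := by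
      rw [hw, Pi.add_apply, HahnSeries.coeff_add, anticausalVec_coeff, constVec_coeff,
        shiftVec_coeff]
      rcases hr.lt_or_eq with h | rfl
      · rw [if_pos h, if_neg h.ne, add_zero]
      · simp
    refine Prod.ext (congrArg e ?_) ?_
    · refine (Submodule.Quotient.eq _).mpr (mem_zeroStates_of_coeff_neg fun i r hr => ?_)
      rw [Pi.sub_apply, HahnSeries.coeff_sub, shiftVec_coeff, shiftVec_coeff,
        hwc i _ (by omega), sub_eq_zero]
      congr 1
      ring
    · ext j
      change ((w ᵥ* G) j).coeff 0 = ((u ᵥ* G) j).coeff t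
      rw [← zero_add t, ← shiftVec_coeff t (u ᵥ* G), ← shiftVec_vecMul, ← sub_eq_zero,
        ← HahnSeries.coeff_sub, ← Pi.sub_apply, ← Matrix.sub_vecMul]
      refine coeff_vecMul_eq_zero fun i r s hrs => ?_
      by_cases hs : s < 0
      · exact Or.inr (hG i j s hs)
      · left
        rw [Pi.sub_apply, HahnSeries.coeff_sub, shiftVec_coeff, hwc i r (by omega), sub_self]

/-! ### The McMillan degree between the internal and the external degree -/

theorem isLeast_finrank_stateSpace (G : Matrix (Fin k) (Fin n) F[X]) :
    IsLeast (encoderDegrees (toLaurent G)) (Module.finrank F (StateSpace (toLaurent G))) := by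
  have := (finite_stateSpace_and_finrank_le_extdeg G).1
  refine ⟨⟨canonicalEncoder (toLaurent G), canonicalEncoder_realizes _ ?_, rfl⟩, ?_⟩
  · exact fun i j t ht => coeff_polyToLaurent_of_neg (G i j) ht
  · rintro _ ⟨E, hE, rfl⟩
    exact hE.finrank_stateSpace_le

theorem mdeg_eq_finrank_stateSpace (G : Matrix (Fin k) (Fin n) F[X]) :
    mdeg (toLaurent G) = Module.finrank F (StateSpace (toLaurent G)) :=
  (isLeast_finrank_stateSpace G).csInf_eq

theorem intdeg_le_mdeg (G : Matrix (Fin k) (Fin n) F[X]) : intdeg G ≤ mdeg (toLaurent G) := by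
  obtain ⟨E, hE, hdeg⟩ := (isLeast_finrank_stateSpace G).1
  rw [mdeg_eq_finrank_stateSpace, ← hdeg]
  exact intdeg_le_degree hE

theorem mdeg_le_extdeg (G : Matrix (Fin k) (Fin n) F[X]) : mdeg (toLaurent G) ≤ extdeg G := by
  rw [mdeg_eq_finrank_stateSpace]
  exact (finite_stateSpace_and_finrank_le_extdeg G).2

end

end ConvCode

theorem corollary1 {F : Type*} [Field F] {k n : ℕ} (G : Matrix (Fin k) (Fin n) (Polynomial F))
    (hG : ConvCode.IsGenerating G) :
    IsLeast (ConvCode.encoderDegrees (ConvCode.toLaurent G))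
      (ConvCode.mdeg (ConvCode.toLaurent G)) ∧
    Module.rank F (ConvCode.StateSpace (ConvCode.toLaurent G)) =
      (ConvCode.mdeg (ConvCode.toLaurent G) : Cardinal) ∧
    ConvCode.intdeg G ≤ ConvCode.mdeg (ConvCode.toLaurent G) ∧
    (ConvCode.IsReduced G →
      ConvCode.intdeg G = ConvCode.mdeg (ConvCode.toLaurent G) ∧
      ConvCode.mdeg (ConvCode.toLaurent G) = ConvCode.extdeg G) := by
  have hfin := (ConvCode.finite_stateSpace_and_finrank_le_extdeg G).1
  have hint := ConvCode.intdeg_le_mdeg G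
  have hext := ConvCode.mdeg_le_extdeg G
  refine ⟨?_, ?_, hint, fun hred => ?_⟩
  · rw [ConvCode.mdeg_eq_finrank_stateSpace]
    exact ConvCode.isLeast_finrank_stateSpace G
  -- Finiteness is needed here, since `finrank` takes the default value 0 in infinite dimension.
  · rw [ConvCode.mdeg_eq_finrank_stateSpace, Module.finrank_eq_rank]
  · have hle := ConvCode.extdeg_le_intdeg_of_isReduced hG hred
    omega
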